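/- A loop is a set $Q$ with a binary operation and a neutral element $1$ such that for every $x\in Q$ the maps $y\mapsto xy$ and $y\mapsto yx$ are bijections of $Q$. Its center $Z(Q)$ consists of all $x\in Q$ with $xy=yx$, $(xy)z=x(yz)$, $(yx)z=y(xz)$ and $(yz)x=y(zx)$ for all $y,z\in Q$. The upper central series of $Q$ is defined by $Z_0(Q)=1$ and $Z_{i+1}(Q)/Z_i(Q)=Z(Q/Z_i(Q))$, and $Q$ is (centrally) nilpotent if $Z_n(Q)=Q$ for some $n\ge 0$. For $n\ge 1$ let $\mathcal N(n)$ be the number of nilpotent loops of order $n$ up to isomorphism. **Theorem.** Let $q$ be an odd prime. For a positive integer $d$ let $$\mathrm{Pred}(d)=\{d' : 1\le d'<d,\ d/d' \text{ is a prime}\}$$ be the set of all maximal proper divisors of $d$. Then $$\mathcal N(2q)=\sum_{d\mid q-1}\frac1d\left(2^{(q-2)d}+\sum_{\emptyset\ne D\subseteq \mathrm{Pred}(d)}(-1)^{|D|}\,2^{(q-2)\gcd D}\right),$$ where $d$ ranges over the positive divisors of $q-1$. -/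

import Mathlib

/-- A set with a binary operation and a two-sided neutral element is a *loop* if all left and all
right multiplications are bijections. -/
class IsLoop (Q : Type*) [MulOneClass Q] : Prop where
  mul_left_bijective : ∀ x : Q, Function.Bijective (fun y : Q => x * y)
  mul_right_bijective : ∀ x : Q, Function.Bijective (fun y : Q => y * x)

/-- A multiplicative congruence for which the quotient is cancellative. On a loop, these are
exactly the congruences whose quotient is again a loop; the class of `1` is then a normal subloop
(the kernel of the projection), and the congruence classes are its cosets. -/
structure LoopCon (Q : Type*) [Mul Q] extends Con Q where
  cancel_left : ∀ a x y : Q, toCon (a * x) (a * y) → toCon x y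
  cancel_right : ∀ a x y : Q, toCon (x * a) (y * a) → toCon x y

namespace LoopCon

/-- The quotient by a loop congruence, with the induced multiplication and neutral element. -/
abbrev Quotient {Q : Type*} [Mul Q] (c : LoopCon Q) : Type _ := c.toCon.Quotient

/-- The quotient of a loop by a loop congruence is a loop. -/
instance isLoop_quotient {Q : Type*} [MulOneClass Q] [IsLoop Q] (c : LoopCon Q) :
    IsLoop c.Quotient where
  mul_left_bijective := by
    intro x
    induction x using Con.induction_on with
    | _ x =>
    constructor
    · intro y z h
      induction y using Con.induction_on with
      | _ y =>
      induction z using Con.induction_on with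
      | _ z => exact (Con.eq _).2 (c.cancel_left x y z ((Con.eq _).1 h))
    · intro y
      induction y using Con.induction_on with
      | _ y =>
      obtain ⟨z, hz⟩ := (IsLoop.mul_left_bijective x).2 y
      exact ⟨(z : c.toCon.Quotient), congrArg (fun t : Q => (t : c.toCon.Quotient)) hz⟩
  mul_right_bijective := by
    intro x
    induction x using Con.induction_on with
    | _ x =>
    constructor
    · intro y z h
      induction y using Con.induction_on with
      | _ y =>
      induction z using Con.induction_on with
      | _ z => exact (Con.eq _).2 (c.cancel_right x y z ((Con.eq _).1 h))
    · intro y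
      induction y using Con.induction_on with
      | _ y =>
      obtain ⟨z, hz⟩ := (IsLoop.mul_right_bijective x).2 y
      exact ⟨(z : c.toCon.Quotient), congrArg (fun t : Q => (t : c.toCon.Quotient)) hz⟩

/-- In a loop, the inverse of a central element is central. -/
theorem exists_central_inverse {Q : Type*} [MulOneClass Q] [IsLoop Q] {z : Q}
    (hz : z ∈ Set.center Q) : ∃ w ∈ Set.center Q, z * w = 1 := by
  obtain ⟨w, hw⟩ := (IsLoop.mul_left_bijective z).2 1
  replace hw : z * w = 1 := hw
  have hz' : IsMulCentral z := hz
  have hc : ∀ a, z * a = a * z := fun a => hz'.comm a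
  have hwz : w * z = 1 := by rw [← hc, hw]
  refine ⟨w, ⟨fun a => ?_, fun b c => ?_, fun a b => ?_⟩, hw⟩
  · apply (IsLoop.mul_left_bijective z).1
    change z * (w * a) = z * (a * w)
    rw [hz'.left_assoc, hz'.left_assoc, hw, one_mul, hc, hz'.mid_assoc, hw, mul_one]
  · apply (IsLoop.mul_left_bijective z).1
    change z * (w * (b * c)) = z * (w * b * c)
    rw [hz'.left_assoc, hz'.left_assoc, hz'.left_assoc, hw, one_mul, one_mul]
  · apply (IsLoop.mul_right_bijective z).1
    change a * b * w * z = a * (b * w) * z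
    rw [hz'.right_assoc, hz'.right_assoc, hz'.right_assoc, hwz, mul_one, mul_one]

/-- Congruence modulo the center: `x` and `y` are related iff they lie in the same coset of the
center. Mathlib's `Set.center Q` consists of the `z` with `z * a = a * z`,
`z * (b * c) = (z * b) * c` and `(a * b) * z = a * (b * z)` for all `a, b, c`; the remaining
identity `(a * z) * c = a * (z * c)` is a consequence of these (`IsMulCentral.mid_assoc`). -/
def central (Q : Type*) [MulOneClass Q] [IsLoop Q] : LoopCon Q where
  r x y := ∃ z ∈ Set.center Q, y = x * z
  iseqv := by
    refine ⟨fun x => ⟨1, Set.one_mem_center, (mul_one x).symm⟩, ?_, ?_⟩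
    · rintro x _ ⟨z, hz, rfl⟩
      obtain ⟨w, hw, h⟩ := exists_central_inverse hz
      exact ⟨w, hw, by rw [hw.right_assoc, h, mul_one]⟩
    · rintro x _ _ ⟨z, hz, rfl⟩ ⟨w, hw, rfl⟩
      exact ⟨z * w, Set.mul_mem_center hz hw, hw.right_assoc _ _⟩
  mul' := by
    rintro x _ y _ ⟨z, hz, rfl⟩ ⟨w, hw, rfl⟩
    refine ⟨z * w, Set.mul_mem_center hz hw, ?_⟩
    have hc : z * y = y * z := hz.comm y
    rw [← hw.right_assoc, hz.mid_assoc, hc, ← hz.right_assoc, hw.right_assoc]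
  cancel_left := by
    rintro a x y ⟨z, hz, h⟩
    exact ⟨z, hz, (IsLoop.mul_left_bijective a).1 (h.trans (hz.right_assoc a x))⟩
  cancel_right := by
    rintro a x y ⟨z, hz, h⟩
    have hc : z * a = a * z := hz.comm a
    refine ⟨z, hz, (IsLoop.mul_right_bijective a).1 (h.trans ?_)⟩
    change x * a * z = x * z * a
    rw [hz.right_assoc, ← hc, hz.mid_assoc]

/-- The preimage of a loop congruence on `Q / c` under the projection `Q → Q / c`. -/
def pullback {Q : Type*} [Mul Q] (c : LoopCon Q) (e : LoopCon c.Quotient) : LoopCon Q where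
  r x y := e.toCon (x : c.Quotient) (y : c.Quotient)
  iseqv := ⟨fun _ => e.toCon.refl _, fun h => e.toCon.symm h, fun h k => e.toCon.trans h k⟩
  mul' h k := e.toCon.mul h k
  cancel_left a x y h := e.cancel_left (a : c.Quotient) (x : c.Quotient) (y : c.Quotient) h
  cancel_right a x y h := e.cancel_right (a : c.Quotient) (x : c.Quotient) (y : c.Quotient) h

/-- Congruence modulo the `n`-th term `Z_n(Q)` of the upper central series: `Z_0(Q) = 1`, and
`Z_{n+1}(Q)` is the preimage in `Q` of the center of `Q / Z_n(Q)`. -/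
def upperCentral (Q : Type*) [MulOneClass Q] [IsLoop Q] : ℕ → LoopCon Q
  | 0 =>
    { r := fun x y => x = y
      iseqv := ⟨fun _ => rfl, Eq.symm, Eq.trans⟩
      mul' := fun h k => congrArg₂ (· * ·) h k
      cancel_left := fun a _ _ h => (IsLoop.mul_left_bijective a).1 h
      cancel_right := fun a _ _ h => (IsLoop.mul_right_bijective a).1 h }
  | n + 1 => (upperCentral Q n).pullback (central (upperCentral Q n).Quotient)

end LoopCon

/-- The `n`-th term `Z_n(Q)` of the upper central series of a loop `Q`. -/
def loopUpperCentralSeries (Q : Type*) [MulOneClass Q] [IsLoop Q] (n : ℕ) : Set Q :=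
  {x | (LoopCon.upperCentral Q n).toCon 1 x}

theorem loopUpperCentralSeries_zero (Q : Type*) [MulOneClass Q] [IsLoop Q] :
    loopUpperCentralSeries Q 0 = {1} := by
  ext x
  exact eq_comm

/-- `Z_{n+1}(Q) / Z_n(Q)` is the center of `Q / Z_n(Q)`. -/
theorem mem_loopUpperCentralSeries_succ {Q : Type*} [MulOneClass Q] [IsLoop Q] (n : ℕ) (x : Q) :
    x ∈ loopUpperCentralSeries Q (n + 1) ↔
      (x : (LoopCon.upperCentral Q n).Quotient) ∈
        Set.center (LoopCon.upperCentral Q n).Quotient := by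
  constructor
  · rintro ⟨z, hz, h⟩
    have h' : (x : (LoopCon.upperCentral Q n).Quotient) = z := h.trans (one_mul z)
    rwa [h']
  · intro h
    exact ⟨_, h, (one_mul (x : (LoopCon.upperCentral Q n).Quotient)).symm⟩

/-- The congruence classes of `LoopCon.upperCentral Q n` are the cosets of `Z_n(Q)`. -/
theorem upperCentral_iff_coset {Q : Type*} [MulOneClass Q] [IsLoop Q] (n : ℕ) (x y : Q) :
    (LoopCon.upperCentral Q n).toCon x y ↔ ∃ z ∈ loopUpperCentralSeries Q n, y = x * z := by
  constructor
  · intro h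
    obtain ⟨z, hz⟩ := (IsLoop.mul_left_bijective x).2 y
    replace hz : x * z = y := hz
    refine ⟨z, (LoopCon.upperCentral Q n).cancel_left x 1 z ?_, hz.symm⟩
    rw [hz, mul_one]
    exact h
  · rintro ⟨z, hz, rfl⟩
    have h := (LoopCon.upperCentral Q n).toCon.mul ((LoopCon.upperCentral Q n).toCon.refl x) hz
    rwa [mul_one] at h

/-- A loop is (centrally) nilpotent if its upper central series reaches the whole loop. -/
def IsNilpotentLoop (Q : Type*) [MulOneClass Q] [IsLoop Q] : Prop :=
  ∃ n : ℕ, loopUpperCentralSeries Q n = Set.univ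

/-- The nilpotent loops of order `n`. For `n = 0` there are none. -/
structure NilpotentLoopOfOrder (n : ℕ) where
  carrier : Type
  [mulOneClass : MulOneClass carrier]
  [isLoop : IsLoop carrier]
  [finite : Finite carrier]
  card_eq : Nat.card carrier = n
  nilpotent : IsNilpotentLoop carrier

attribute [instance] NilpotentLoopOfOrder.mulOneClass
attribute [instance] NilpotentLoopOfOrder.isLoop
attribute [instance] NilpotentLoopOfOrder.finite

/-- Isomorphism of nilpotent loops of order `n`. -/
def nilpotentLoopIso (n : ℕ) : Setoid (NilpotentLoopOfOrder n) where
  r L M := Nonempty (L.carrier ≃* M.carrier)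
  iseqv := ⟨fun _ => ⟨MulEquiv.refl _⟩, fun ⟨e⟩ => ⟨e.symm⟩, fun ⟨e⟩ ⟨f⟩ => ⟨e.trans f⟩⟩

/-- The number of nilpotent loops of order `n` up to isomorphism. -/
noncomputable def numNilpotentLoops (n : ℕ) : ℕ :=
  Nat.card (Quotient (nilpotentLoopIso n))

/-- The set of all maximal proper divisors `d'` of `d`, that is, `1 ≤ d' < d` and `d / d'` is
a prime. -/
def maxProperDivisors (d : ℕ) : Finset ℕ :=
  {d' ∈ Finset.Ico 1 d | d' ∣ d ∧ (d / d').Prime}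

/-!
Why the formula holds: nilpotent loops of order `2q` are classified by necklaces of length `q - 1`
with `2 ^ (q - 2)` colours, and the right-hand side counts these necklaces.

*Reduction to cocycles.* Let `Q` be nilpotent of order `2q`. Its center is nontrivial and its order
divides `2q`. Index two is impossible (`center_eq_univ_of_card_quotient_eq_two`), so either `Q` is a
commutative group, or the center has order two; in the latter case the quotient by the center has
prime order and nontrivial center, hence is a cyclic group. Either way `Q` is a central extension of
`ZMod q` by `ZMod 2` (`IsNilpotentLoop.exists_mulEquiv_centralExt`), given on
`ZMod q × ZMod 2` by an arbitrary normalized map `θ : ZMod q × ZMod q → ZMod 2`. Conversely all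
these extensions are nilpotent. As `q` is odd, the nontrivial element of `{0} × ZMod 2` is the only
involution of such an extension, so isomorphisms preserve `{0} × ZMod 2`, and two extensions are
isomorphic if and only if their cocycles agree up to coboundaries and the action
`θ (x, y) ↦ θ (u x, u y)` of a unit `u` of `ZMod q`
(`CentralExt.exists_unit_cochain_of_mulEquiv`).

*Normal form.* The coboundary `τ (x + y) - τ x - τ y` has row sums `∑ y` equal to `-q τ x = τ x` in
`ZMod 2`. Hence each cohomology class contains exactly one cocycle with vanishing row sums, and this
choice is compatible with the action of the units. Writing such a cocycle as
`θ (x, x t) = k x t` identifies it with a function `k` from `(ZMod q)ˣ` to the set of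
rows `r` with `r 0 = 0` and `∑ t, r t = 0`, which has `2 ^ (q - 2)` elements, and the units act by
translating the argument of `k`. So the isomorphism classes are the orbits of the cyclic group
`(ZMod q)ˣ` on these functions (`numNilpotentLoops_two_mul`).

*Counting.* If `g` generates a cyclic group `G` and `d` divides the order of `G`, then the functions
`G → K` fixed by `g ^ d` are the functions on the `d` cosets of the subgroup generated by `g ^ d`.
The number with orbit of size exactly `d` follows by inclusion–exclusion over the maximal proper
divisors of `d`, and dividing by `d` gives the number of orbits of size `d` (`card_necklaces`).
-/

/-! ### Counting the orbits of a finite cyclic group -/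

theorem eq_iff_dvd_and_forall_maxProperDivisors {d : ℕ} (hd : 0 < d) (p : ℕ) :
    p = d ↔ p ∣ d ∧ ∀ d' ∈ maxProperDivisors d, ¬ p ∣ d' := by
  constructor
  · rintro rfl
    refine ⟨dvd_rfl, fun d' hd' h => ?_⟩
    simp only [maxProperDivisors, Finset.mem_filter, Finset.mem_Ico] at hd'
    exact absurd (Nat.le_of_dvd hd'.1.1 h) (by omega)
  · rintro ⟨⟨r, rfl⟩, h⟩
    have hp : 0 < p := Nat.pos_of_mul_pos_right hd
    have hr : 0 < r := Nat.pos_of_mul_pos_left hd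
    by_contra hne
    have hr1 : r ≠ 1 := by rintro rfl; simp at hne
    obtain ⟨l, hl, s, rfl⟩ := Nat.exists_prime_and_dvd hr1
    have hs : 0 < s := Nat.pos_of_mul_pos_left hr
    refine h (p * s) ?_ (dvd_mul_right _ _)
    have e : p * (l * s) = p * s * l := by ring
    have hps : 0 < p * s := Nat.mul_pos hp hs
    simp only [maxProperDivisors, Finset.mem_filter, Finset.mem_Ico]
    rw [e]
    refine ⟨⟨hps, ?_⟩, dvd_mul_right _ _, ?_⟩
    · nlinarith [hl.two_le]
    · rwa [Nat.mul_div_cancel_left _ hps]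

/-- Inclusion–exclusion over the maximal proper divisors of `d`: the condition `p = d` expressed by
divisibility conditions on `p`. -/
theorem indicator_eq_sum_maxProperDivisors {d : ℕ} (hd : 0 < d) (p : ℕ) :
    (if p = d then 1 else 0 : ℚ) = (if p ∣ d then 1 else 0) +
      ∑ D ∈ (maxProperDivisors d).powerset with D.Nonempty,
        (-1 : ℚ) ^ D.card * (if p ∣ D.gcd id then 1 else 0) := by
  have h1 : (if p = d then 1 else 0 : ℚ) =
      (if p ∣ d then 1 else 0) * ∏ d' ∈ maxProperDivisors d, (-(if p ∣ d' then 1 else 0) + 1) := by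
    rw [if_congr (eq_iff_dvd_and_forall_maxProperDivisors hd p) rfl rfl]
    by_cases h : p ∣ d
    · simp only [h, true_and, if_true, one_mul]
      split_ifs with h2
      · exact (Finset.prod_eq_one fun i hi => by simp [h2 i hi]).symm
      · push Not at h2
        obtain ⟨i, hi, hpi⟩ := h2
        exact (Finset.prod_eq_zero hi (by simp [hpi])).symm
    · simp [h]
  have h2 : ∀ D : Finset ℕ, (∏ i ∈ D, -(if p ∣ i then 1 else 0 : ℚ)) =
      (-1 : ℚ) ^ D.card * (if p ∣ D.gcd id then 1 else 0) := by
    intro D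
    rw [Finset.prod_neg, Finset.prod_boole]
    simp [Finset.dvd_gcd_iff]
  rw [h1, Finset.prod_add, Finset.mul_sum,
    ← Finset.sum_filter_add_sum_filter_not _ Finset.Nonempty, add_comm]
  congr 1
  · rw [Finset.sum_eq_single ∅]
    · simp
    · intro D hD hne
      simp only [Finset.mem_filter, Finset.not_nonempty_iff_eq_empty] at hD
      exact absurd hD.2 hne
    · simp
  · refine Finset.sum_congr rfl fun D hD => ?_
    simp only [Finset.mem_filter, Finset.mem_powerset] at hD
    rw [h2, Finset.prod_const_one, mul_one]
    by_cases h : p ∣ D.gcd id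
    · obtain ⟨i, hi⟩ := hD.2
      have hid := hD.1 hi
      simp only [maxProperDivisors, Finset.mem_filter] at hid
      have : p ∣ d := (h.trans (Finset.gcd_dvd hi)).trans hid.2.1
      simp [this]
    · simp [h]

theorem card_orbits_eq_sum_inv (G X : Type*) [Group G] [MulAction G X] [Fintype X] :
    (Nat.card (MulAction.orbitRel.Quotient G X) : ℚ) =
      ∑ x : X, (1 / (Nat.card (MulAction.orbit G x) : ℚ)) := by
  classical
  have : Fintype (MulAction.orbitRel.Quotient G X) := Fintype.ofFinite _
  have hfib : ∀ ω : MulAction.orbitRel.Quotient G X,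
      ∑ x : X with (Quotient.mk _ x : MulAction.orbitRel.Quotient G X) = ω,
        (1 / (Nat.card (MulAction.orbit G x) : ℚ)) = 1 := by
    intro ω
    induction ω using Quotient.inductionOn with
    | _ y =>
    have hmem : ∀ x : X, (Quotient.mk (MulAction.orbitRel G X) x = Quotient.mk _ y) ↔
        x ∈ MulAction.orbit G y := fun x => Quotient.eq
    have hcard : Finset.card {x : X | Quotient.mk (MulAction.orbitRel G X) x = Quotient.mk _ y} =
        Nat.card (MulAction.orbit G y) := by
      rw [Nat.card_coe_set_eq, Set.ncard_eq_toFinset_card']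
      congr 1
      ext x
      simp [hmem]
    rw [Finset.sum_congr rfl (g := fun _ => 1 / (Nat.card (MulAction.orbit G y) : ℚ)),
      Finset.sum_const, hcard, nsmul_eq_mul, mul_one_div_cancel]
    · have : Nonempty (MulAction.orbit G y) := ⟨⟨y, MulAction.mem_orbit_self y⟩⟩
      exact_mod_cast Nat.card_pos.ne'
    · intro x hx
      have hx' := (hmem x).1 (Finset.mem_filter.1 hx).2
      rw [MulAction.orbit_eq_iff.2 hx']
  rw [Nat.card_eq_fintype_card, ← Finset.card_univ, Finset.card_eq_sum_ones, Nat.cast_sum,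
    ← Finset.sum_fiberwise Finset.univ
      (fun x => (Quotient.mk _ x : MulAction.orbitRel.Quotient G X))]
  exact Finset.sum_congr rfl fun ω _ => by rw [hfib]; simp

/-- The number of orbits of a cyclic group `G = ⟨g⟩` in terms of the numbers of fixed points `F d`
of the powers `g ^ d`: the points with orbit of size `d` are counted by inclusion–exclusion over the
maximal proper divisors of `d`, since a point is fixed by `g ^ i` for all `i ∈ D` if and only if it
is fixed by `g ^ gcd D`. -/
theorem card_orbits_of_zpowers_eq_top {G X : Type*} [Group G] [Finite G] [MulAction G X] [Finite X]
    {g : G} (hg : Subgroup.zpowers g = ⊤) (F : ℕ → ℚ)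
    (hF : ∀ d, d ∣ Nat.card G → (Nat.card {x : X // g ^ d • x = x} : ℚ) = F d) :
    (Nat.card (MulAction.orbitRel.Quotient G X) : ℚ) =
      ∑ d ∈ (Nat.card G).divisors, (1 / (d : ℚ)) *
        (F d + ∑ D ∈ (maxProperDivisors d).powerset with D.Nonempty,
          (-1 : ℚ) ^ D.card * F (D.gcd id)) := by
  classical
  have : Fintype X := Fintype.ofFinite _
  set per : X → ℕ := Function.minimalPeriod (fun x => g • x) with hper
  have hdvd : ∀ x d, g ^ d • x = x ↔ per x ∣ d := fun x d => by
    rw [hper, ← Function.isPeriodicPt_iff_minimalPeriod_dvd, Function.IsPeriodicPt,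
      Function.IsFixedPt, smul_iterate]
  have hG : ∀ x, per x ∣ Nat.card G := fun x => by rw [← hdvd, pow_card_eq_one', one_smul]
  have horb : ∀ x : X, Nat.card (MulAction.orbit G x) = per x := by
    intro x
    have e : MulAction.orbit (Subgroup.zpowers g) x = MulAction.orbit G x := by
      ext y
      constructor
      · rintro ⟨⟨h, _⟩, rfl⟩
        exact ⟨h, rfl⟩
      · rintro ⟨h, rfl⟩
        exact ⟨⟨h, by rw [hg]; trivial⟩, rfl⟩
    rw [hper, MulAction.minimalPeriod_eq_card, ← Nat.card_eq_fintype_card, e]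
  have hcount : ∀ d, d ∣ Nat.card G → (∑ x : X, (if per x ∣ d then 1 else 0 : ℚ)) = F d := by
    intro d hd
    rw [← hF d hd, Finset.sum_boole, Nat.card_eq_fintype_card, Fintype.card_subtype]
    simp only [hdvd]
  rw [card_orbits_eq_sum_inv]
  have hsplit : ∀ x : X, (1 / (Nat.card (MulAction.orbit G x) : ℚ)) =
      ∑ d ∈ (Nat.card G).divisors, (1 / (d : ℚ)) * (if per x = d then 1 else 0) := by
    intro x
    rw [horb, Finset.sum_eq_single (per x)]
    · simp
    · intro d _ hne
      simp [hne.symm]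
    · intro h
      exact absurd (Nat.mem_divisors.2 ⟨hG x, Nat.card_pos.ne'⟩) h
  rw [Finset.sum_congr rfl fun x _ => hsplit x, Finset.sum_comm]
  refine Finset.sum_congr rfl fun d hd => ?_
  have hd' := Nat.dvd_of_mem_divisors hd
  rw [← Finset.mul_sum, ← hcount d hd',
    Finset.sum_congr rfl fun x _ =>
      indicator_eq_sum_maxProperDivisors (Nat.pos_of_mem_divisors hd) (per x),
    Finset.sum_add_distrib, Finset.sum_comm]
  congr 2
  refine Finset.sum_congr rfl fun D hD => ?_
  simp only [Finset.mem_filter, Finset.mem_powerset] at hD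
  obtain ⟨i, hi⟩ := hD.2
  have hid := hD.1 hi
  simp only [maxProperDivisors, Finset.mem_filter] at hid
  rw [← Finset.mul_sum, hcount _ (((Finset.gcd_dvd hi).trans hid.2.1).trans hd')]

attribute [local instance] arrowAction in
/-- Colourings of a finite group fixed under translation by `h` are colourings of the set of cosets
of the subgroup generated by `h`. -/
theorem card_fixed_arrow {G K : Type*} [Group G] [Finite G] (h : G) :
    Nat.card {f : G → K // h • f = f} = Nat.card K ^ (Subgroup.zpowers h).index := by
  have hinv : ∀ f : G → K, h • f = f ↔ ∀ x, f (h * x) = f x := by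
    intro f
    constructor
    · intro e x
      conv_lhs => rw [← e]
      change f (h⁻¹ • (h * x)) = f x
      simp
    · intro e
      funext x
      change f (h⁻¹ * x) = f x
      rw [← e, mul_inv_cancel_left]
  let s := MulAction.orbitRel (Subgroup.zpowers h) G
  have hcard : Nat.card (Quotient s) = (Subgroup.zpowers h).index := by
    have hs : s = QuotientGroup.rightRel (Subgroup.zpowers h) := rfl
    rw [hs, Nat.card_congr (QuotientGroup.quotientRightRelEquivQuotientLeftRel _)]
    rfl
  have hpow : ∀ f : G → K, h • f = f → ∀ a b, s.r a b → f a = f b := by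
    rintro f e a b ⟨⟨u, hu⟩, rfl⟩
    change f (u * b) = f b
    have hst : h⁻¹ ∈ MulAction.stabilizer G f := by
      rw [inv_mem_iff]
      exact e
    have hu' : u⁻¹ ∈ MulAction.stabilizer G f := by
      rw [inv_mem_iff]
      exact (Subgroup.zpowers_le.2 (MulAction.mem_stabilizer_iff.2 e)) hu
    have : u⁻¹ • f = f := hu'
    conv_rhs => rw [← this]
    change _ = f (u⁻¹⁻¹ * b)
    rw [inv_inv]
  let e : {f : G → K // h • f = f} ≃ (Quotient s → K) :=
    { toFun := fun f => Quotient.lift f.1 (hpow f.1 f.2)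
      invFun := fun F => ⟨fun x => F (Quotient.mk s x), (hinv _).2 fun x =>
        congrArg F (Quotient.sound ⟨⟨h, Subgroup.mem_zpowers h⟩, rfl⟩)⟩
      left_inv := fun f => rfl
      right_inv := fun F => by
        funext ω
        induction ω using Quotient.inductionOn with
        | _ x => rfl }
  have : Finite (Quotient s) := Quotient.finite s
  rw [Nat.card_congr e, Nat.card_fun, hcard]

attribute [local instance] arrowAction in
/-- The number of necklaces: orbits of colourings of a finite cyclic group under translation. -/
theorem card_necklaces {G K : Type*} [Group G] [Finite G] [IsCyclic G] [Finite K] :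
    (Nat.card (MulAction.orbitRel.Quotient G (G → K)) : ℚ) =
      ∑ d ∈ (Nat.card G).divisors, (1 / (d : ℚ)) *
        ((Nat.card K : ℚ) ^ d + ∑ D ∈ (maxProperDivisors d).powerset with D.Nonempty,
          (-1 : ℚ) ^ D.card * (Nat.card K : ℚ) ^ D.gcd id) := by
  obtain ⟨g, hg⟩ := IsCyclic.exists_generator (α := G)
  have hg' : Subgroup.zpowers g = ⊤ := (Subgroup.eq_top_iff' _).2 hg
  refine card_orbits_of_zpowers_eq_top hg' (fun d => (Nat.card K : ℚ) ^ d) fun d hd => ?_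
  have ho : orderOf g = Nat.card G := orderOf_eq_card_of_forall_mem_zpowers hg
  have hd0 : d ≠ 0 := by
    rintro rfl
    exact Nat.card_pos.ne' (zero_dvd_iff.1 hd)
  have hidx : (Subgroup.zpowers (g ^ d)).index = d := by
    have h := Subgroup.card_mul_index (Subgroup.zpowers (g ^ d))
    rw [Nat.card_zpowers, orderOf_pow_of_dvd hd0 (ho ▸ hd), ho] at h
    obtain ⟨e, he⟩ := hd
    have he0 : 0 < e := Nat.pos_of_ne_zero fun h0 => Nat.card_pos.ne' (by rw [he, h0, mul_zero])
    rw [he, Nat.mul_div_cancel_left _ (Nat.pos_of_ne_zero hd0), mul_comm d] at h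
    exact Nat.eq_of_mul_eq_mul_left he0 h
  rw [card_fixed_arrow, hidx, Nat.cast_pow]

/-! ### Loop congruences and the upper central series -/

/-- A loop is partitioned into the classes of a loop congruence, which all have the size of the
class of `1`. -/
theorem LoopCon.card_eq {Q : Type*} [MulOneClass Q] [IsLoop Q] (c : LoopCon Q) :
    Nat.card Q = Nat.card c.Quotient * Nat.card {x : Q // c.toCon 1 x} := by
  have hout : ∀ ω : c.Quotient, ((Quotient.out ω : Q) : c.Quotient) = ω := fun ω =>
    Quotient.out_eq ω
  let φ : c.Quotient × {x : Q // c.toCon 1 x} → Q := fun p => Quotient.out p.1 * p.2.1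
  have hmk : ∀ p, (φ p : c.Quotient) = p.1 := by
    rintro ⟨ω, w, hw⟩
    change ((Quotient.out ω : Q) : c.Quotient) * (w : c.Quotient) = ω
    rw [← (Con.eq _).2 hw, hout]
    exact mul_one ω
  rw [← Nat.card_prod]
  refine (Nat.card_congr (Equiv.ofBijective φ ⟨?_, ?_⟩)).symm
  · rintro ⟨ω, w⟩ ⟨ω', w'⟩ h
    have hω : ω = ω' := by
      have := congrArg (fun x : Q => (x : c.Quotient)) h
      simpa only [hmk] using this
    subst hω
    exact Prod.ext rfl (Subtype.ext ((IsLoop.mul_left_bijective _).1 h))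
  · intro y
    obtain ⟨w, hw⟩ := (IsLoop.mul_left_bijective (Quotient.out (y : c.Quotient) : Q)).2 y
    refine ⟨⟨y, w, ?_⟩, hw⟩
    refine c.cancel_left (Quotient.out (y : c.Quotient)) _ _ ?_
    refine (Con.eq _).1 ?_
    rw [mul_one, hout]
    exact congrArg (fun x : Q => (x : c.Quotient)) hw.symm

theorem central_one_iff {Q : Type*} [MulOneClass Q] [IsLoop Q] {x : Q} :
    (LoopCon.central Q).toCon 1 x ↔ x ∈ Set.center Q := by
  change (∃ z ∈ Set.center Q, x = 1 * z) ↔ _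
  simp

theorem card_center_dvd_card (Q : Type*) [MulOneClass Q] [IsLoop Q] :
    Nat.card (Set.center Q) ∣ Nat.card Q := by
  rw [(LoopCon.central Q).card_eq,
    Nat.card_congr (Equiv.subtypeEquivRight fun x => central_one_iff)]
  exact dvd_mul_left _ _

theorem mk_mem_center_of_forall {Q : Type*} [MulOneClass Q] (c : LoopCon Q) {z : Q}
    (h₁ : ∀ a, c.toCon (z * a) (a * z)) (h₂ : ∀ a b, c.toCon (z * (a * b)) (z * a * b))
    (h₃ : ∀ a b, c.toCon (a * b * z) (a * (b * z))) :
    (z : c.Quotient) ∈ Set.center c.Quotient := by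
  refine ⟨fun a => ?_, fun a b => ?_, fun a b => ?_⟩
  · induction a using Con.induction_on with
    | _ a => exact (Con.eq _).2 (h₁ a)
  · induction a using Con.induction_on with
    | _ a =>
    induction b using Con.induction_on with
    | _ b => exact (Con.eq _).2 (h₂ a b)
  · induction a using Con.induction_on with
    | _ a =>
    induction b using Con.induction_on with
    | _ b => exact (Con.eq _).2 (h₃ a b)

theorem loopUpperCentralSeries_one (Q : Type*) [MulOneClass Q] [IsLoop Q] :
    loopUpperCentralSeries Q 1 = Set.center Q := by
  ext x
  rw [mem_loopUpperCentralSeries_succ]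
  constructor
  · intro h
    have inj : ∀ {a b : Q}, (a : (LoopCon.upperCentral Q 0).Quotient) = b → a = b :=
      fun h => (Con.eq _).1 h
    exact ⟨fun a => inj (h.comm (a : (LoopCon.upperCentral Q 0).Quotient)),
      fun a b => inj (h.left_assoc (a : (LoopCon.upperCentral Q 0).Quotient) b),
      fun a b => inj (h.right_assoc (a : (LoopCon.upperCentral Q 0).Quotient) b)⟩
  · intro h
    exact mk_mem_center_of_forall _ (fun a => h.comm a) (fun a b => h.left_assoc a b)
      (fun a b => h.right_assoc a b)

theorem upperCentral_stationary {Q : Type*} [MulOneClass Q] [IsLoop Q] {n : ℕ}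
    (h : ∀ z ∈ Set.center (LoopCon.upperCentral Q n).Quotient, z = 1) (k : ℕ) :
    LoopCon.upperCentral Q (n + k) = LoopCon.upperCentral Q n := by
  let φ : LoopCon Q → LoopCon Q := fun c => c.pullback (LoopCon.central c.Quotient)
  have toCon_injective : ∀ c c' : LoopCon Q, c.toCon = c'.toCon → c = c' := by
    rintro ⟨c, _, _⟩ ⟨c', _, _⟩ (rfl : c = c')
    rfl
  have h1 : φ (LoopCon.upperCentral Q n) = LoopCon.upperCentral Q n := by
    refine toCon_injective _ _ (Con.ext fun x y => ⟨?_, fun hxy => ?_⟩)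
    · rintro ⟨z, hz, hy⟩
      rw [h z hz] at hy
      exact (Con.eq _).1 (hy.trans (mul_one _)).symm
    · exact ⟨1, Set.one_mem_center, ((Con.eq _).2 hxy).symm.trans (mul_one _).symm⟩
  induction k with
  | zero => rfl
  | succ k ih => exact (congrArg φ ih).trans h1

theorem loopUpperCentralSeries_mono (Q : Type*) [MulOneClass Q] [IsLoop Q] :
    Monotone (loopUpperCentralSeries Q) := by
  refine monotone_nat_of_le_succ fun n x hx => ?_
  rw [mem_loopUpperCentralSeries_succ, ← (Con.eq _).2 hx]
  exact Set.one_mem_center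

/-- In a nilpotent loop, the quotient by a proper term of the upper central series has a nontrivial
center, since otherwise the series would be constant from this term on. -/
theorem IsNilpotentLoop.exists_mem_center_ne_one {Q : Type*} [MulOneClass Q] [IsLoop Q]
    (hQ : IsNilpotentLoop Q) {n : ℕ} (hn : loopUpperCentralSeries Q n ≠ Set.univ) :
    ∃ z ∈ Set.center (LoopCon.upperCentral Q n).Quotient, z ≠ 1 := by
  by_contra! h
  obtain ⟨m, hm⟩ := hQ
  apply hn
  have h1 : loopUpperCentralSeries Q (n + m) = loopUpperCentralSeries Q n := by
    unfold loopUpperCentralSeries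
    rw [upperCentral_stationary h]
  rw [← h1, Set.eq_univ_iff_forall]
  intro x
  refine loopUpperCentralSeries_mono Q (Nat.le_add_left m n) ?_
  rw [hm]
  trivial

/-- A loop all of whose elements are central is a commutative group. -/
noncomputable abbrev commGroupOfCenter {Q : Type*} [MulOneClass Q] [IsLoop Q]
    (h : ∀ x : Q, x ∈ Set.center Q) : CommGroup Q :=
  { (inferInstance : MulOneClass Q) with
    mul_assoc := fun a b c => ((h a).left_assoc b c).symm
    mul_comm := fun a b => (h a).comm b
    inv := fun a => Classical.choose (LoopCon.exists_central_inverse (h a))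
    inv_mul_cancel := fun a =>
      ((h a).comm _).symm.trans (Classical.choose_spec (LoopCon.exists_central_inverse (h a))).2 }

/-! ### Central extensions by normalized cocycles -/

/-- A normalized loop cocycle: an arbitrary map `F × F → A` vanishing when an argument is `0`. As
central extensions in the category of loops need not be associative, there is no further
condition. -/
structure NormalizedCocycle (F A : Type) [AddCommGroup F] [AddCommGroup A] where
  /-- The underlying map. -/
  toFun : F → F → A
  zero_left : ∀ y, toFun 0 y = 0
  zero_right : ∀ x, toFun x 0 = 0

/-- The underlying set `F × A` of the central extension of `F` by `A` with cocycle `θ`. -/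
@[ext]
structure CentralExt {F A : Type} [AddCommGroup F] [AddCommGroup A]
    (θ : NormalizedCocycle F A) where
  /-- The component in the quotient. -/
  fst : F
  /-- The component in the central subgroup. -/
  snd : A

namespace CentralExt

variable {F A : Type} [AddCommGroup F] [AddCommGroup A] {θ θ' : NormalizedCocycle F A}

/-- The multiplication `(x, a) (y, b) = (x + y, a + b + θ (x, y))`. -/
instance : MulOneClass (CentralExt θ) where
  mul p r := ⟨p.fst + r.fst, p.snd + r.snd + θ.toFun p.fst r.fst⟩
  one := ⟨0, 0⟩
  one_mul p := by
    refine CentralExt.ext (zero_add p.fst) ?_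
    change 0 + p.snd + θ.toFun 0 p.fst = p.snd
    rw [θ.zero_left, zero_add, add_zero]
  mul_one p := by
    refine CentralExt.ext (add_zero p.fst) ?_
    change p.snd + 0 + θ.toFun p.fst 0 = p.snd
    rw [θ.zero_right, add_zero, add_zero]

@[simp] theorem one_fst : (1 : CentralExt θ).fst = 0 := rfl
@[simp] theorem one_snd : (1 : CentralExt θ).snd = 0 := rfl
@[simp] theorem mul_fst (p r : CentralExt θ) : (p * r).fst = p.fst + r.fst := rfl
@[simp] theorem mul_snd (p r : CentralExt θ) :
    (p * r).snd = p.snd + r.snd + θ.toFun p.fst r.fst := rfl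

instance : IsLoop (CentralExt θ) where
  mul_left_bijective p := by
    refine Function.bijective_iff_has_inverse.2
      ⟨fun r => ⟨r.fst - p.fst, r.snd - p.snd - θ.toFun p.fst (r.fst - p.fst)⟩,
        fun r => ?_, fun r => ?_⟩
    · ext
      · simp
      · simp only [mul_fst, mul_snd, add_sub_cancel_left]
        abel
    · ext
      · simp
      · simp only [mul_snd]
        abel
  mul_right_bijective p := by
    refine Function.bijective_iff_has_inverse.2
      ⟨fun r => ⟨r.fst - p.fst, r.snd - p.snd - θ.toFun (r.fst - p.fst) p.fst⟩,
        fun r => ?_, fun r => ?_⟩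
    · ext
      · simp
      · simp
        abel
    · ext
      · simp
      · simp only [mul_snd]
        abel

/-- The central extension has underlying set `F × A`. -/
def equivProd (θ : NormalizedCocycle F A) : CentralExt θ ≃ F × A where
  toFun p := (p.fst, p.snd)
  invFun p := ⟨p.1, p.2⟩
  left_inv _ := rfl
  right_inv _ := rfl

instance [Finite F] [Finite A] : Finite (CentralExt θ) := Finite.of_equiv _ (equivProd θ).symm

theorem card : Nat.card (CentralExt θ) = Nat.card F * Nat.card A := by
  rw [Nat.card_congr (equivProd θ), Nat.card_prod]

theorem mem_center_of_fst_eq_zero {z : CentralExt θ} (hz : z.fst = 0) : z ∈ Set.center _ := by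
  refine ⟨fun a => ?_, fun a b => ?_, fun a b => ?_⟩
  · change z * a = a * z
    ext <;> simp [hz, θ.zero_left, θ.zero_right, add_comm]
  all_goals
    ext
    · simp [hz]
    · simp [hz, θ.zero_left, θ.zero_right]
      abel

/-- The central extension is nilpotent of class at most two. -/
theorem isNilpotentLoop : IsNilpotentLoop (CentralExt θ) := by
  have hcon : ∀ p r : CentralExt θ, p.fst = r.fst → (LoopCon.upperCentral _ 1).toCon p r := by
    intro p r h
    rw [upperCentral_iff_coset, loopUpperCentralSeries_one]
    refine ⟨⟨0, r.snd - p.snd⟩, mem_center_of_fst_eq_zero rfl, ?_⟩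
    ext <;> simp [h, θ.zero_right]
  refine ⟨2, Set.eq_univ_iff_forall.2 fun p => ?_⟩
  rw [mem_loopUpperCentralSeries_succ]
  exact mk_mem_center_of_forall _ (fun a => hcon _ _ (add_comm _ _))
    (fun a b => hcon _ _ (add_assoc _ _ _).symm) (fun a b => hcon _ _ (add_assoc _ _ _))

/-- The isomorphism `(x, a) ↦ (u x, a + τ x)` between extensions whose cocycles agree up to the
automorphism `u` and the coboundary of `τ`. -/
def mulEquivOfCohomologous (u : F ≃+ F) (τ : F → A)
    (h : ∀ x y, θ'.toFun (u x) (u y) + (τ x + τ y) = θ.toFun x y + τ (x + y)) :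
    CentralExt θ ≃* CentralExt θ' where
  toFun p := ⟨u p.fst, p.snd + τ p.fst⟩
  invFun p := ⟨u.symm p.fst, p.snd - τ (u.symm p.fst)⟩
  left_inv p := by ext <;> simp
  right_inv p := by ext <;> simp
  map_mul' p r := by
    ext
    · simp
    · simp only [mul_snd]
      change _ + τ (p.fst + r.fst) = p.snd + τ p.fst + (r.snd + τ r.fst) + _
      rw [add_assoc, ← h]
      abel

end CentralExt

/-- A loop which maps onto `F` with kernel a central subgroup `A` is a central extension of `F` by
`A`: the cocycle measures the failure of a section `F → Q` to be multiplicative. -/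
theorem exists_mulEquiv_centralExt {F A Q : Type} [AddCommGroup F] [AddCommGroup A] [MulOneClass Q]
    [IsLoop Q] (π : Q → F) (hπ : ∀ x y, π (x * y) = π x + π y) (hsurj : Function.Surjective π)
    (ι : A → Q) (hι : ∀ a b, ι (a + b) = ι a * ι b) (hinj : Function.Injective ι)
    (hcen : ∀ a, ι a ∈ Set.center Q) (hker : ∀ x, π x = 0 ↔ x ∈ Set.range ι) :
    ∃ θ : NormalizedCocycle F A, Nonempty (CentralExt θ ≃* Q) := by
  classical
  have hπ1 : π 1 = 0 := by simpa using hπ 1 1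
  have hι0 : ι 0 = 1 := by
    have h := hι 0 0
    rw [add_zero] at h
    exact ((IsLoop.mul_left_bijective (ι 0)).1 ((mul_one _).trans h)).symm
  have hπι : ∀ a, π (ι a) = 0 := fun a => (hker _).2 ⟨a, rfl⟩
  obtain ⟨s, hs, hs0⟩ : ∃ s : F → Q, (∀ x, π (s x) = x) ∧ s 0 = 1 := by
    refine ⟨fun x => if x = 0 then 1 else Function.surjInv hsurj x, fun x => ?_, if_pos rfl⟩
    dsimp only
    split_ifs with h
    · rw [h, hπ1]
    · exact Function.surjInv_eq hsurj x
  have hex : ∀ y r, π y = π r → ∃ a, y * ι a = r := by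
    intro y r h
    obtain ⟨w, hw⟩ := (IsLoop.mul_left_bijective y).2 r
    replace hw : y * w = r := hw
    have hw0 : π w = 0 := by
      rw [← hw, hπ] at h
      simpa using h
    obtain ⟨a, rfl⟩ := (hker w).1 hw0
    exact ⟨a, hw⟩
  have hθ : ∀ x y, ∃ a, s (x + y) * ι a = s x * s y := fun x y => hex _ _ (by simp [hπ, hs])
  choose θ hθ using hθ
  have hcancel : ∀ y a, y * ι a = y → a = 0 := fun y a h =>
    hinj (((IsLoop.mul_left_bijective y).1 (h.trans (mul_one y).symm)).trans hι0.symm)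
  refine ⟨⟨θ, fun y => ?_, fun x => ?_⟩, ⟨MulEquiv.ofBijective
    (⟨fun p => s p.fst * ι p.snd, fun p r => ?_⟩ : CentralExt _ →ₙ* Q) ⟨?_, ?_⟩⟩⟩
  · have h := hθ 0 y
    rw [hs0, zero_add, one_mul] at h
    exact hcancel _ _ h
  · have h := hθ x 0
    rw [hs0, add_zero, mul_one] at h
    exact hcancel _ _ h
  · change s (p.fst + r.fst) * ι (p.snd + r.snd + θ p.fst r.fst) =
      s p.fst * ι p.snd * (s r.fst * ι r.snd)
    have hc : ι p.snd * s r.fst = s r.fst * ι p.snd := (hcen p.snd).comm _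
    rw [← (hcen r.snd).right_assoc, (hcen p.snd).mid_assoc, hc,
      ← (hcen p.snd).right_assoc, (hcen r.snd).right_assoc, ← hι, ← hθ,
      (hcen (p.snd + r.snd)).right_assoc, ← hι, add_comm (θ _ _)]
  · intro p r h
    replace h : s p.fst * ι p.snd = s r.fst * ι r.snd := h
    have h1 : p.fst = r.fst := by simpa [hπ, hs, hπι] using congrArg π h
    rw [h1] at h
    exact CentralExt.ext h1 (hinj ((IsLoop.mul_left_bijective _).1 h))
  · intro y
    obtain ⟨a, ha⟩ := hex (s (π y)) y (hs _)
    exact ⟨⟨π y, a⟩, ha⟩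

/-! ### Nilpotent loops of order `2q` are central extensions -/

/-- A loop whose center had index two would be generated by one element over its center, hence be a
commutative group; so this index does not occur. -/
theorem center_eq_univ_of_card_quotient_eq_two {Q : Type*} [MulOneClass Q] [IsLoop Q]
    (h : Nat.card (LoopCon.central Q).Quotient = 2) : Set.center Q = Set.univ := by
  rw [Set.eq_univ_iff_forall]
  intro x
  by_contra hx
  obtain ⟨ω, hω, huniq⟩ := (Nat.card_eq_two_iff' (1 : (LoopCon.central Q).Quotient)).1 h
  have hone : ∀ y : Q, (y : (LoopCon.central Q).Quotient) = 1 ↔ y ∈ Set.center Q := fun y => by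
    rw [← central_one_iff, eq_comm]
    exact Con.eq _
  have hcoset : ∀ y : Q, y ∈ Set.center Q ∨ ∃ w ∈ Set.center Q, y = x * w := by
    intro y
    by_cases hy : y ∈ Set.center Q
    · exact Or.inl hy
    · refine Or.inr ?_
      have h1 := huniq x fun e => hx ((hone x).1 e)
      have h2 := huniq y fun e => hy ((hone y).1 e)
      exact (Con.eq _).1 (h1.trans h2.symm)
  have ht : x * x ∈ Set.center Q := by
    rcases hcoset (x * x) with h1 | ⟨w, hw, h1⟩
    · exact h1
    · exact absurd ((IsLoop.mul_left_bijective x).1 h1 ▸ hw) hx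
  have hcomm : ∀ w ∈ Set.center Q, x * w = w * x := fun w hw => (IsMulCentral.comm hw x).symm
  -- the product of two elements of the coset of `x` is central
  have hprod : ∀ w ∈ Set.center Q, ∀ v ∈ Set.center Q, x * w * (x * v) = x * x * (w * v) := by
    intro w hw v hv
    rw [← hv.right_assoc, hw.mid_assoc, ← hcomm w hw, ← hw.right_assoc, hv.right_assoc]
  have hmul : ∀ a b, a ∈ Set.center Q → b ∈ Set.center Q → a * b ∈ Set.center Q :=
    fun a b ha hb => Set.mul_mem_center ha hb
  have hcomm' : ∀ a, x * a = a * x := by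
    intro a
    rcases hcoset a with ha | ⟨w, hw, rfl⟩
    · exact hcomm a ha
    · rw [hw.mid_assoc, ← hcomm w hw]
  refine hx ⟨hcomm', fun b c => ?_, fun a b => ?_⟩
  · rcases hcoset b with hb | ⟨w, hw, rfl⟩
    · exact (hb.mid_assoc x c).symm
    rcases hcoset c with hc | ⟨v, hv, rfl⟩
    · exact (hc.right_assoc x (x * w)).symm
    rw [hprod w hw v hv, ← hw.right_assoc x x, IsMulCentral.left_assoc (hmul _ _ ht hw),
      ← hcomm' (x * x * w), hv.right_assoc, hv.right_assoc]
  · rcases hcoset a with ha | ⟨w, hw, rfl⟩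
    · exact (ha.left_assoc b x).symm
    rcases hcoset b with hb | ⟨v, hv, rfl⟩
    · exact hb.mid_assoc (x * w) x
    have htw : x * x * w = w * (x * x) := IsMulCentral.comm ht w
    rw [hprod w hw v hv, ← hcomm', ← hcomm' (x * v), ← hv.right_assoc x x, hw.mid_assoc,
      hw.left_assoc, ← htw, hv.right_assoc]

theorem exists_bijective_zmod_of_card_prime {L : Type*} [Group L] {q : ℕ} (hq : q.Prime)
    (h : Nat.card L = q) :
    ∃ e : L → ZMod q, Function.Bijective e ∧ ∀ x y, e (x * y) = e x + e y := by
  subst h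
  have : Fact (Nat.card L).Prime := ⟨hq⟩
  let e := (zmodCyclicMulEquiv (isCyclic_of_prime_card (α := L) rfl)).symm
  exact ⟨fun x => (e x).toAdd, e.bijective, fun x y => congrArg _ (e.map_mul x y)⟩

theorem exists_mulEquiv_centralExt_of_involution {q : ℕ} {Q : Type} [MulOneClass Q] [IsLoop Q]
    {z : Q} (hz : z ∈ Set.center Q) (hz1 : z ≠ 1) (hzz : z * z = 1) (π : Q → ZMod q)
    (hπ : ∀ x y, π (x * y) = π x + π y) (hsurj : Function.Surjective π)
    (hker : ∀ x, π x = 0 ↔ x = 1 ∨ x = z) :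
    ∃ θ : NormalizedCocycle (ZMod q) (ZMod 2), Nonempty (CentralExt θ ≃* Q) := by
  have h01 : ∀ a : ZMod 2, a = 0 ∨ a = 1 := by decide
  have h2 : (1 : ZMod 2) + 1 = 0 := rfl
  refine exists_mulEquiv_centralExt π hπ hsurj (fun a : ZMod 2 => if a = 0 then 1 else z)
    ?_ ?_ ?_ ?_
  · intro a b
    rcases h01 a with rfl | rfl <;> rcases h01 b with rfl | rfl <;> simp [h2, hzz]
  · intro a b
    rcases h01 a with rfl | rfl <;> rcases h01 b with rfl | rfl <;> simp [hz1, hz1.symm]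
  · intro a
    split_ifs
    · exact Set.one_mem_center
    · exact hz
  · intro x
    rw [hker]
    constructor
    · rintro (rfl | rfl)
      · exact ⟨0, by simp⟩
      · exact ⟨1, by simp⟩
    · rintro ⟨a, rfl⟩
      dsimp only
      split_ifs
      · exact Or.inl rfl
      · exact Or.inr rfl

/-- The abelian case: a commutative group of order `2q` maps onto its quotient by a subgroup of
order two. -/
theorem CommGroup.exists_mulEquiv_centralExt {q : ℕ} (hq : q.Prime) {Q : Type} [CommGroup Q]
    [IsLoop Q] (hcard : Nat.card Q = 2 * q) :
    ∃ θ : NormalizedCocycle (ZMod q) (ZMod 2), Nonempty (CentralExt θ ≃* Q) := by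
  have : Finite Q := Nat.finite_of_card_ne_zero (by rw [hcard]; have := hq.pos; omega)
  have : Fact (Nat.Prime 2) := ⟨Nat.prime_two⟩
  obtain ⟨z, hz⟩ := exists_prime_orderOf_dvd_card' (G := Q) 2
    (by rw [hcard]; exact dvd_mul_right _ _)
  have hz2 : z ^ 2 = 1 := by rw [← hz, pow_orderOf_eq_one]
  have hz1 : z ≠ 1 := by
    rintro rfl
    simp at hz
  have hmem : ∀ x, x ∈ Subgroup.zpowers z ↔ x = 1 ∨ x = z := by
    intro x
    constructor
    · rintro ⟨k, rfl⟩
      obtain ⟨m, rfl | rfl⟩ := Int.even_or_odd' k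
      · simp [zpow_mul, hz2]
      · simp [zpow_add, zpow_mul, hz2]
    · rintro (rfl | rfl)
      · exact one_mem _
      · exact Subgroup.mem_zpowers _
  have hquot : Nat.card (Q ⧸ Subgroup.zpowers z) = q := by
    have h := Subgroup.card_eq_card_quotient_mul_card_subgroup (Subgroup.zpowers z)
    rw [hcard, Nat.card_zpowers, hz] at h
    omega
  obtain ⟨e, he, hmul⟩ := exists_bijective_zmod_of_card_prime hq hquot
  have he1 : e 1 = 0 := by simpa using hmul 1 1
  refine exists_mulEquiv_centralExt_of_involution (z := z)
    (by rw [Set.center_eq_univ]; trivial) hz1 (by rw [← pow_two, hz2])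
    (fun x => e (x : Q ⧸ Subgroup.zpowers z)) (fun x y => hmul x y)
    (he.2.comp (QuotientGroup.mk_surjective)) fun x => ?_
  rw [← hmem, ← QuotientGroup.eq_one_iff, ← he1]
  exact he.1.eq_iff

/-- Every nilpotent loop of order `2q` is a central extension of the cyclic group of order `q` by
the group of order two: the order of its center is `2`, or the loop is a commutative group. -/
theorem IsNilpotentLoop.exists_mulEquiv_centralExt {q : ℕ} (hq : q.Prime) {Q : Type} [MulOneClass Q]
    [IsLoop Q] (hQ : IsNilpotentLoop Q) (hcard : Nat.card Q = 2 * q) :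
    ∃ θ : NormalizedCocycle (ZMod q) (ZMod 2), Nonempty (CentralExt θ ≃* Q) := by
  have hq0 := hq.two_le
  have : Finite Q := Nat.finite_of_card_ne_zero (by omega)
  by_cases huniv : Set.center Q = Set.univ
  · let inst := commGroupOfCenter (Set.eq_univ_iff_forall.1 huniv)
    exact CommGroup.exists_mulEquiv_centralExt hq hcard
  have hcardQ := (LoopCon.central Q).card_eq
  rw [Nat.card_congr (Equiv.subtypeEquivRight fun x => central_one_iff), hcard] at hcardQ
  set c := LoopCon.upperCentral Q 1 with hc
  have hcone : ∀ x, c.toCon 1 x ↔ x ∈ Set.center Q := fun x => by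
    rw [← loopUpperCentralSeries_one]
    rfl
  have hcardc := c.card_eq
  rw [Nat.card_congr (Equiv.subtypeEquivRight hcone), hcard] at hcardc
  change 2 * q = _ * Nat.card (Set.center Q) at hcardQ
  change 2 * q = _ * Nat.card (Set.center Q) at hcardc
  -- the center is nontrivial
  obtain ⟨z, hz, hz1⟩ : ∃ z ∈ Set.center Q, z ≠ 1 := by
    have hne : loopUpperCentralSeries Q 0 ≠ Set.univ := by
      intro h
      rw [loopUpperCentralSeries_zero] at h
      have h1 : Nat.card (Set.univ : Set Q) = 1 := by rw [← h]; simp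
      rw [Nat.card_univ, hcard] at h1
      omega
    obtain ⟨ω, hω, hω1⟩ := hQ.exists_mem_center_ne_one hne
    induction ω using Con.induction_on with
    | _ x =>
    refine ⟨x, ?_, fun h => hω1 (by rw [h]; rfl)⟩
    rw [← loopUpperCentralSeries_one, mem_loopUpperCentralSeries_succ]
    exact hω
  -- so is the center of the quotient by the center
  obtain ⟨w, hw, hw1⟩ := hQ.exists_mem_center_ne_one (n := 1)
    (by rwa [loopUpperCentralSeries_one])
  have hZ1 : Nat.card (Set.center Q) ≠ 1 := by
    intro h
    have hs := (Nat.card_eq_one_iff_unique.1 h).1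
    exact hz1 (congrArg Subtype.val (hs.elim ⟨z, hz⟩ ⟨1, Set.one_mem_center⟩))
  have hZ2 : Nat.card (Set.center Q) = 2 := by
    rcases (Nat.Prime.dvd_mul hq).1 (Dvd.intro_left _ hcardQ) with ⟨j, hj⟩ | ⟨j, hj⟩
    · have hj2 : j * Nat.card (Set.center Q) = 2 :=
        Nat.eq_of_mul_eq_mul_left hq.pos (by rw [← mul_assoc, ← hj, ← hcardQ, mul_comm])
      exact ((Nat.dvd_prime Nat.prime_two).1 (Dvd.intro_left _ hj2)).resolve_left hZ1
    · exfalso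
      have hj2 : Nat.card (LoopCon.central Q).Quotient * j = 2 := by
        refine Nat.eq_of_mul_eq_mul_right hq.pos ?_
        rw [mul_assoc, mul_comm j, ← hj, ← hcardQ]
      apply huniv
      rcases (Nat.dvd_prime Nat.prime_two).1 (Dvd.intro _ hj2) with h | h
      · rw [h, one_mul] at hcardQ
        refine Set.eq_of_subset_of_ncard_le (Set.subset_univ _) ?_
        rw [Set.ncard_univ, hcard, ← Nat.card_coe_set_eq, hcardQ]
      · exact center_eq_univ_of_card_quotient_eq_two h
  have hL : Nat.card c.Quotient = q := by
    rw [hZ2] at hcardc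
    omega
  have : Finite c.Quotient := Quotient.finite _
  have hcenL : ∀ x : c.Quotient, x ∈ Set.center c.Quotient := by
    have hd := card_center_dvd_card c.Quotient
    rw [hL] at hd
    rcases (Nat.dvd_prime hq).1 hd with h | h
    · have hs := (Nat.card_eq_one_iff_unique.1 h).1
      exact absurd (congrArg Subtype.val (hs.elim ⟨w, hw⟩ ⟨1, Set.one_mem_center⟩)) hw1
    · refine Set.eq_univ_iff_forall.1 (Set.eq_of_subset_of_ncard_le (Set.subset_univ _) ?_)
      rw [Set.ncard_univ, hL, ← Nat.card_coe_set_eq, h]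
  let inst := commGroupOfCenter hcenL
  obtain ⟨e, he, hmul⟩ := exists_bijective_zmod_of_card_prime hq hL
  have he1 : e 1 = 0 := by simpa using hmul 1 1
  have hZ : ∀ x, x ∈ Set.center Q ↔ x = 1 ∨ x = z := by
    intro x
    constructor
    · intro hx
      by_contra! hne
      obtain ⟨_, _, huniq⟩ :=
        (Nat.card_eq_two_iff' (⟨1, Set.one_mem_center⟩ : Set.center Q)).1 hZ2
      have h1 := huniq ⟨x, hx⟩ fun h => hne.1 (congrArg Subtype.val h)
      have h2 := huniq ⟨z, hz⟩ fun h => hz1 (congrArg Subtype.val h)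
      exact hne.2 (congrArg Subtype.val (h1.trans h2.symm))
    · rintro (rfl | rfl)
      · exact Set.one_mem_center
      · exact hz
  refine exists_mulEquiv_centralExt_of_involution hz hz1 ?_ (fun x => e (x : c.Quotient))
    (fun x y => hmul (x : c.Quotient) (y : c.Quotient)) (he.2.comp Quotient.mk_surjective)
    fun x => ?_
  · rcases (hZ _).1 (Set.mul_mem_center hz hz) with h | h
    · exact h
    · exact absurd ((IsLoop.mul_left_bijective z).1 (h.trans (mul_one z).symm)) hz1
  · rw [← hZ, ← hcone, ← he1, he.1.eq_iff]
    exact ⟨fun h => c.toCon.symm ((Con.eq _).1 h), fun h => (Con.eq _).2 (c.toCon.symm h)⟩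

/-! ### Isomorphisms between the central extensions -/

/-- An isomorphism of extensions by a group of order two is given by a unit `u` and a cochain `τ`:
the kernel `{0} × ZMod 2` is preserved because, `q` being odd, its nontrivial element is the only
involution. -/
theorem CentralExt.exists_unit_cochain_of_mulEquiv {q : ℕ} [Fact q.Prime] (hodd : Odd q)
    {θ θ' : NormalizedCocycle (ZMod q) (ZMod 2)} (e : CentralExt θ ≃* CentralExt θ') :
    ∃ (u : (ZMod q)ˣ) (τ : ZMod q → ZMod 2), ∀ x y,
      θ'.toFun (u * x) (u * y) + (τ x + τ y) = θ.toFun x y + τ (x + y) := by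
  have h01 : ∀ a : ZMod 2, a = 0 ∨ a = 1 := by decide
  have h2 : (2 : ZMod q) ≠ 0 := by
    intro h
    have h' : ((2 : ℕ) : ZMod q) = 0 := by exact_mod_cast h
    have hq2 := (Nat.prime_dvd_prime_iff_eq (Fact.out : q.Prime) Nat.prime_two).1
      ((ZMod.natCast_eq_zero_iff _ _).1 h')
    subst hq2
    exact absurd hodd (by decide)
  have hsq : (⟨0, 1⟩ : CentralExt θ) * ⟨0, 1⟩ = 1 := by
    ext
    · simp
    · simp only [mul_snd, one_snd, θ.zero_left]
      rfl
  have hinv : e ⟨0, 1⟩ = ⟨0, 1⟩ := by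
    have h1 : e ⟨0, 1⟩ * e ⟨0, 1⟩ = 1 := by rw [← map_mul, hsq, map_one]
    have hfst : (e ⟨0, 1⟩).fst = 0 := by
      have h := congrArg CentralExt.fst h1
      rw [mul_fst, one_fst, ← two_mul] at h
      exact (mul_eq_zero.1 h).resolve_left h2
    refine CentralExt.ext hfst ((h01 _).resolve_left fun hsnd => ?_)
    have : (⟨0, 1⟩ : CentralExt θ) = 1 :=
      e.injective ((CentralExt.ext hfst hsnd).trans (map_one e).symm)
    exact one_ne_zero (congrArg CentralExt.snd this)
  have hker : ∀ a, e ⟨0, a⟩ = ⟨0, a⟩ := by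
    intro a
    rcases h01 a with rfl | rfl
    · exact map_one e
    · exact hinv
  have hdecomp : ∀ p, e p = ⟨(e ⟨p.fst, 0⟩).fst, (e ⟨p.fst, 0⟩).snd + p.snd⟩ := by
    intro p
    have hp : p = ⟨p.fst, 0⟩ * ⟨0, p.snd⟩ := by ext <;> simp [θ.zero_right]
    conv_lhs => rw [hp, map_mul, hker]
    ext <;> simp [θ'.zero_right]
  have hmul : ∀ x y, (⟨x, 0⟩ : CentralExt θ) * ⟨y, 0⟩ = ⟨x + y, θ.toFun x y⟩ := by
    intro x y
    ext <;> simp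
  have hadd : ∀ x y, e ⟨x, 0⟩ * e ⟨y, 0⟩ =
      ⟨(e ⟨x + y, 0⟩).fst, (e ⟨x + y, 0⟩).snd + θ.toFun x y⟩ := by
    intro x y
    rw [← map_mul, hmul, hdecomp]
  let α : ZMod q →+ ZMod q := AddMonoidHom.mk' (fun x => (e ⟨x, 0⟩).fst) fun x y =>
    (congrArg CentralExt.fst (hadd x y)).symm
  have hα : ∀ x, α x = α 1 * x := by
    intro x
    obtain ⟨n, rfl⟩ := ZMod.natCast_zmod_surjective x
    rw [← nsmul_one n, map_nsmul, nsmul_eq_mul, nsmul_eq_mul, mul_one, mul_comm]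
  have hα1 : α 1 ≠ 0 := by
    intro h
    have h1 : e ⟨1, 0⟩ = e ⟨0, (e ⟨1, 0⟩).snd⟩ := by
      rw [hker]
      exact CentralExt.ext h rfl
    exact one_ne_zero (congrArg CentralExt.fst (e.injective h1))
  refine ⟨Units.mk0 _ hα1, fun x => (e ⟨x, 0⟩).snd, fun x y => ?_⟩
  have h := congrArg CentralExt.snd (hadd x y)
  rw [mul_snd] at h
  change _ + θ'.toFun (α x) (α y) = _ at h
  rw [hα x, hα y] at h
  rw [Units.val_mk0, add_comm, h]
  exact add_comm _ _

/-! ### Normal forms for cocycles -/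

/-- The possible rows of a normalized cocycle all of whose row sums vanish. -/
abbrev ZeroSumRow (q : ℕ) [NeZero q] : Type :=
  {r : ZMod q → ZMod 2 // r 0 = 0 ∧ ∑ y, r y = 0}

theorem card_zeroSumRow (q : ℕ) [Fact q.Prime] : Nat.card (ZeroSumRow q) = 2 ^ (q - 2) := by
  let φ : (ZMod q → ZMod 2) →+ ZMod 2 × ZMod 2 :=
    AddMonoidHom.mk' (fun r => (r 0, ∑ y, r y)) fun r s => by
      simp [Finset.sum_add_distrib]
  have hφ : Function.Surjective φ := by
    rintro ⟨a, b⟩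
    refine ⟨Pi.single 0 a + Pi.single 1 (b - a), ?_⟩
    change ((_ : ZMod 2), (_ : ZMod 2)) = _
    simp [Finset.sum_add_distrib]
  have h := AddSubgroup.card_eq_card_quotient_mul_card_addSubgroup φ.ker
  rw [Nat.card_congr (QuotientAddGroup.quotientKerEquivOfSurjective φ hφ).toEquiv, Nat.card_fun,
    Nat.card_prod, Nat.card_zmod, Nat.card_zmod] at h
  have e : ZeroSumRow q ≃ φ.ker := Equiv.subtypeEquivRight fun r => by
    rw [AddMonoidHom.mem_ker]
    exact Prod.mk_eq_zero.symm
  rw [Nat.card_congr e]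
  have hpow : 2 ^ q = 2 ^ (q - 2) * 2 ^ 2 := by
    rw [← pow_add, Nat.sub_add_cancel (Fact.out : q.Prime).two_le]
  omega

section ZeroRowSums

variable {q : ℕ} [Fact q.Prime]

open CentralExt

/-- The normalized cocycle whose row at a unit `x` is `k x`, the columns being rescaled by `x`. In
these coordinates the automorphisms of `ZMod q` act by translation of the argument of `k`. -/
noncomputable def necklaceCocycle (k : (ZMod q)ˣ → ZeroSumRow q) :
    NormalizedCocycle (ZMod q) (ZMod 2) where
  toFun x y := if h : x = 0 then 0 else (k (Units.mk0 x h)).1 (y / x)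
  zero_left y := dif_pos rfl
  zero_right x := by
    split_ifs with h
    · rfl
    · rw [zero_div]
      exact (k _).2.1

theorem necklaceCocycle_unit_mul (k : (ZMod q)ˣ → ZeroSumRow q) (u : (ZMod q)ˣ) (t : ZMod q) :
    (necklaceCocycle k).toFun u (u * t) = (k u).1 t := by
  change (if h : (u : ZMod q) = 0 then 0 else (k (Units.mk0 u h)).1 (u * t / u)) = _
  rw [dif_neg u.ne_zero, Units.mk0_val, mul_div_cancel_left₀ t u.ne_zero]

theorem sum_unit_mul {M : Type*} [AddCommMonoid M] (u : (ZMod q)ˣ) (f : ZMod q → M) :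
    ∑ y, f (u * y) = ∑ y, f y :=
  Equiv.sum_comp (Units.mulLeft u) f

theorem sum_add_left_zmod {M : Type*} [AddCommMonoid M] (x : ZMod q) (f : ZMod q → M) :
    ∑ y, f (x + y) = ∑ y, f y :=
  Equiv.sum_comp (Equiv.addLeft x) f

theorem eq_zero_or_exists_unit (x : ZMod q) : x = 0 ∨ ∃ u : (ZMod q)ˣ, x = u :=
  or_iff_not_imp_left.2 fun h => ⟨Units.mk0 x h, rfl⟩

theorem sum_necklaceCocycle (k : (ZMod q)ˣ → ZeroSumRow q) (x : ZMod q) :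
    ∑ y, (necklaceCocycle k).toFun x y = 0 := by
  rcases eq_zero_or_exists_unit x with rfl | ⟨u, rfl⟩
  · simp [(necklaceCocycle k).zero_left]
  · rw [← sum_unit_mul u]
    simp only [necklaceCocycle_unit_mul, (k u).2.2]

theorem sum_const_zmod_two (hodd : Odd q) (a : ZMod 2) : ∑ _y : ZMod q, a = a := by
  rw [Finset.sum_const, Finset.card_univ, ZMod.card, nsmul_eq_mul,
    (ZMod.natCast_eq_one_iff_odd).2 hodd, one_mul]

/-- A cohomology class contains at most one cocycle with vanishing row sums: the coboundary of `τ`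
has row sums `q • τ = τ`. -/
theorem eq_of_cohomologous_of_sum_eq_zero (hodd : Odd q)
    {θ θ' : NormalizedCocycle (ZMod q) (ZMod 2)} (hθ : ∀ x, ∑ y, θ.toFun x y = 0)
    (hθ' : ∀ x, ∑ y, θ'.toFun x y = 0) (u : (ZMod q)ˣ)
    (τ : ZMod q → ZMod 2)
    (h : ∀ x y, θ'.toFun (u * x) (u * y) + (τ x + τ y) = θ.toFun x y + τ (x + y)) (x y : ZMod q) :
    θ'.toFun (u * x) (u * y) = θ.toFun x y := by
  have hτ : ∀ x, τ x = 0 := by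
    intro x
    have hs := Finset.sum_congr (rfl : (Finset.univ : Finset (ZMod q)) = _) fun y _ => h x y
    rw [Finset.sum_add_distrib, Finset.sum_add_distrib, Finset.sum_add_distrib,
      sum_unit_mul u (θ'.toFun (u * x)), hθ, hθ', sum_const_zmod_two hodd,
      sum_add_left_zmod] at hs
    simpa using hs
  simpa [hτ] using h x y

/-- Every cohomology class contains a cocycle with vanishing row sums: add the coboundary of the
row sums. -/
theorem exists_mulEquiv_necklaceCocycle (hodd : Odd q) (θ : NormalizedCocycle (ZMod q) (ZMod 2)) :
    ∃ k : (ZMod q)ˣ → ZeroSumRow q, Nonempty (CentralExt θ ≃* CentralExt (necklaceCocycle k)) := by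
  let τ : ZMod q → ZMod 2 := fun x => ∑ y, θ.toFun x y
  have hτ0 : τ 0 = 0 := Finset.sum_eq_zero fun y _ => θ.zero_left y
  let η : ZMod q → ZMod q → ZMod 2 := fun x y => θ.toFun x y + τ (x + y) + (τ x + τ y)
  have hη0 : ∀ x, η x 0 = 0 := fun x => by
    simp only [η, θ.zero_right, hτ0, add_zero, zero_add, CharTwo.add_self_eq_zero]
  have hηsum : ∀ x, ∑ y, η x y = 0 := fun x => by
    simp only [η]
    rw [Finset.sum_add_distrib, Finset.sum_add_distrib, Finset.sum_add_distrib,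
      sum_const_zmod_two hodd, sum_add_left_zmod, add_add_add_comm,
      CharTwo.add_self_eq_zero (∑ y, τ y), add_zero]
    exact CharTwo.add_self_eq_zero (τ x)
  let k : (ZMod q)ˣ → ZeroSumRow q := fun u =>
    ⟨fun t => η u (u * t), (congrArg (η u) (mul_zero _)).trans (hη0 u),
      by rw [sum_unit_mul u (η u), hηsum]⟩
  have hk : ∀ x y, (necklaceCocycle k).toFun x y = η x y := by
    intro x y
    rcases eq_zero_or_exists_unit x with rfl | ⟨u, rfl⟩
    · rw [(necklaceCocycle k).zero_left]
      simp only [η, θ.zero_left, hτ0, zero_add, CharTwo.add_self_eq_zero]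
    · rw [← Units.mul_inv_cancel_left u y, necklaceCocycle_unit_mul]
  refine ⟨k, ⟨mulEquivOfCohomologous (AddEquiv.refl _) τ fun x y => ?_⟩⟩
  rw [AddEquiv.refl_apply, AddEquiv.refl_apply, hk, add_assoc, CharTwo.add_self_eq_zero, add_zero]

attribute [local instance] arrowAction in
/-- The extensions attached to two necklaces are isomorphic if and only if the necklaces agree up to
rotation. -/
theorem nonempty_mulEquiv_necklaceCocycle_iff (hodd : Odd q) (k k' : (ZMod q)ˣ → ZeroSumRow q) :
    Nonempty (CentralExt (necklaceCocycle k) ≃* CentralExt (necklaceCocycle k')) ↔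
      MulAction.orbitRel (ZMod q)ˣ ((ZMod q)ˣ → ZeroSumRow q) k k' := by
  constructor
  · rintro ⟨e⟩
    obtain ⟨u, τ, h⟩ := exists_unit_cochain_of_mulEquiv hodd e
    have h' := eq_of_cohomologous_of_sum_eq_zero hodd (sum_necklaceCocycle k)
      (sum_necklaceCocycle k') u τ h
    refine ⟨u⁻¹, funext fun v => Subtype.ext (funext fun t => ?_)⟩
    change (k' (u⁻¹⁻¹ * v)).1 t = (k v).1 t
    rw [inv_inv, ← necklaceCocycle_unit_mul, ← necklaceCocycle_unit_mul, ← h', Units.val_mul,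
      mul_assoc]
  · rintro ⟨g, rfl⟩
    refine ⟨mulEquivOfCohomologous (AddAut.mulLeft g⁻¹) (fun _ => 0) fun x y => ?_⟩
    rw [add_zero, add_zero, add_zero, AddAut.mulLeft_apply_apply, AddAut.mulLeft_apply_apply,
      Units.smul_def, Units.smul_def, smul_eq_mul, smul_eq_mul]
    rcases eq_zero_or_exists_unit x with rfl | ⟨u, rfl⟩
    · rw [mul_zero, NormalizedCocycle.zero_left, NormalizedCocycle.zero_left]
    · rw [← Units.mul_inv_cancel_left u y, necklaceCocycle_unit_mul, ← mul_assoc, ← Units.val_mul,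
        necklaceCocycle_unit_mul]
      rfl

end ZeroRowSums

attribute [local instance] arrowAction in
/-- Nilpotent loops of order `2q` are classified by necklaces of length `q - 1` with beads in
`ZeroSumRow q`. -/
theorem numNilpotentLoops_two_mul {q : ℕ} [Fact q.Prime] (hodd : Odd q) :
    numNilpotentLoops (2 * q) =
      Nat.card (MulAction.orbitRel.Quotient (ZMod q)ˣ ((ZMod q)ˣ → ZeroSumRow q)) := by
  let L : ((ZMod q)ˣ → ZeroSumRow q) → NilpotentLoopOfOrder (2 * q) := fun k =>
    { carrier := CentralExt (necklaceCocycle k)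
      card_eq := by rw [CentralExt.card, Nat.card_zmod, Nat.card_zmod, mul_comm]
      nilpotent := CentralExt.isNilpotentLoop }
  let f : MulAction.orbitRel.Quotient (ZMod q)ˣ ((ZMod q)ˣ → ZeroSumRow q) →
      Quotient (nilpotentLoopIso (2 * q)) :=
    Quotient.map L fun k k' h => (nonempty_mulEquiv_necklaceCocycle_iff hodd k k').2 h
  refine (Nat.card_eq_of_bijective f ⟨?_, ?_⟩).symm
  · intro ω ω' h
    induction ω using Quotient.inductionOn with
    | _ k =>
    induction ω' using Quotient.inductionOn with
    | _ k' =>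
    exact Quotient.sound ((nonempty_mulEquiv_necklaceCocycle_iff hodd k k').1 (Quotient.exact h))
  · intro ω
    induction ω using Quotient.inductionOn with
    | _ M =>
    obtain ⟨θ, ⟨e⟩⟩ :=
      IsNilpotentLoop.exists_mulEquiv_centralExt (Fact.out : q.Prime) M.nilpotent M.card_eq
    obtain ⟨k, ⟨e'⟩⟩ := exists_mulEquiv_necklaceCocycle hodd θ
    exact ⟨Quotient.mk _ k, Quotient.sound ⟨e'.symm.trans e⟩⟩

theorem theorem6p1 (q : ℕ) (hq : q.Prime) (hodd : Odd q) :
    (numNilpotentLoops (2 * q) : ℚ) =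
      ∑ d ∈ (q - 1).divisors, (1 / (d : ℚ)) *
        ((2 : ℚ) ^ ((q - 2) * d) +
          ∑ D ∈ (maxProperDivisors d).powerset with D.Nonempty,
            (-1 : ℚ) ^ D.card * (2 : ℚ) ^ ((q - 2) * D.gcd id)) := by
  have : Fact q.Prime := ⟨hq⟩
  have hcard : Nat.card (ZMod q)ˣ = q - 1 := by rw [Nat.card_eq_fintype_card, ZMod.card_units]
  rw [numNilpotentLoops_two_mul hodd, card_necklaces, hcard, card_zeroSumRow]
  simp only [Nat.cast_pow, Nat.cast_ofNat, pow_mul]
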